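/- Conventions. Rings are associative with unit. For a right $R$-module $M$, $\operatorname{Soc}(M)$ denotes the sum of its simple submodules. The (right) socle sequence of $R$ is defined by $S_0=0$, $S_{\alpha+1}/S_\alpha=\operatorname{Soc}(R/S_\alpha)$, and $S_\alpha=\bigcup_{\beta<\alpha}S_\beta$ for limit ordinals $\alpha$. A ring $R$ is right semiartinian if every nonzero factor module of the right module $R$ has nonzero socle; if moreover $R\neq 0$, then the least ordinal $\alpha$ with $S_\alpha=R$ has the form $\sigma+1$, and this defines $\sigma$. For $\alpha\le\sigma$, the $\alpha$th layer is $L_\alpha=S_{\alpha+1}/S_\alpha$, and $\lambda_\alpha$ is the number of homogeneous components of $L_\alpha$ (one for each isomorphism class of simple submodules of $L_\alpha$). The layers $L_\alpha$ with $0<\alpha<\sigma$ are called proper. $R$ is von Neumann regular if for each $r\in R$ there is $s\in R$ with $rsr=r$, and $R$ has primitive factors artinian (pfa) if $R/P$ is right artinian for each right primitive ideal $P$ (for von Neumann regular rings the properties semiartinian and pfa, and the socle sequence, are left-right symmetric). $R$ is left (right) hereditary if all its left (right) ideals are projective. "Countable" includes finite. Lemma. Let $R\ne 0$ be a semiartinian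 von Neumann regular ring with pfa. For each $0<\alpha<\sigma$, the layer $L_\alpha$ is countably generated if and only if $\lambda_\alpha$ is countable. Consider the following two conditions: (1) $R$ is left and right hereditary. (2) $\sigma$ is a countable ordinal, and all proper layers of $R$ are countably generated. Then (2) implies (1). Moreover, if $\lambda_0$ is countable, then (1) and (2) are equivalent. -/

import Mathlib

universe u v

open Cardinal

/-! Right modules over `R` are modules over `Rᵐᵒᵖ`; in particular the right ideals of `R` are the
elements of `Submodule Rᵐᵒᵖ R`. -/

namespace SemiartinianRing

section Modules

variable (A : Type v) [Ring A] (M : Type u) [AddCommGroup M] [Module A M]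

/-- The socle of a module: the sum of all its simple submodules. -/
def socle : Submodule A M := sSup {N : Submodule A M | IsSimpleModule A N}

/-- The submodule `N'` of `M` with `N ≤ N'` and `N' / N = Soc (M / N)`. -/
def socleStep (N : Submodule A M) : Submodule A M := (socle A (M ⧸ N)).comap N.mkQ

/-- The socle sequence of `M`: `S 0 = 0`, `S (α + 1) / S α = Soc (M / S α)`, and
`S α = ⋃ β < α, S β` at limit ordinals `α`. -/
noncomputable def socleSeq (α : Ordinal.{u}) : Submodule A M :=
  transfiniteIterate (socleStep A M) α ⊥

/-- The `α`th layer `L α = S (α + 1) / S α` of `M`. -/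
abbrev Layer (α : Ordinal.{u}) : Type u :=
  socleSeq A M (α + 1) ⧸ (socleSeq A M α).submoduleOf (socleSeq A M (α + 1))

/-- A module is semiartinian if each of its nonzero factor modules has a nonzero socle. -/
def IsSemiartinian : Prop := ∀ N : Submodule A M, N ≠ ⊤ → socle A (M ⧸ N) ≠ ⊥

/-- The Loewy length of a semiartinian module: the least ordinal `α` such that `S α = M`.
(Its value is `0` if there is no such `α`.) -/
noncomputable def loewyLength : Ordinal.{u} := sInf {α | socleSeq A M α = ⊤}

/-- `M` has a countable (possibly finite) generating set. -/
def IsCountablyGenerated : Prop := ∃ s : Set M, s.Countable ∧ Submodule.span A s = ⊤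

end Modules

section Rings

variable (R : Type u) [Ring R]

/-- Von Neumann regular rings. -/
def IsVonNeumannRegular : Prop := ∀ r : R, ∃ s : R, r * s * r = r

/-- A (two-sided) ideal is right primitive if it is the annihilator of a simple right module. -/
def IsRightPrimitive (P : Ideal R) : Prop :=
  ∃ (M : Type u) (_ : AddCommGroup M) (_ : Module Rᵐᵒᵖ M), IsSimpleModule Rᵐᵒᵖ M ∧
    ∀ r : R, r ∈ P ↔ ∀ m : M, MulOpposite.op r • m = 0

/-- Right primitive factors artinian: `R / P` is a right artinian ring for each right primitive
ideal `P`. -/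
def HasRightPFA : Prop :=
  ∀ (P : Ideal R) [P.IsTwoSided], IsRightPrimitive R P → IsArtinian (R ⧸ P)ᵐᵒᵖ (R ⧸ P)

/-- Every left ideal is projective. -/
def IsLeftHereditary : Prop := ∀ I : Submodule R R, Module.Projective R I

/-- Every right ideal is projective. -/
def IsRightHereditary : Prop := ∀ I : Submodule Rᵐᵒᵖ R, Module.Projective Rᵐᵒᵖ I

/-- The `α`th layer of the ring `R`, formed with respect to its right socle sequence. -/
abbrev RightLayer (α : Ordinal.{u}) : Type u := Layer Rᵐᵒᵖ R α

/-- The number of homogeneous components of the `α`th layer of `R`. -/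
noncomputable def numComponents (α : Ordinal.{u}) : Cardinal.{u} :=
  #(isotypicComponents Rᵐᵒᵖ (RightLayer R α))

end Rings

end SemiartinianRing

open SemiartinianRing

/-!
Over a von Neumann regular ring cyclic one-sided ideals are direct summands, hence so are the
finitely generated ones. A countably generated one-sided ideal is a union of a chain of summands,
and the projections onto the members of the chain exhibit it as a projective module
(`projective_of_isCountablyGenerated`); semisimple one-sided ideals are projective as well, being
direct sums of cyclic ones. Consequently `J ⊔ T` is projective whenever `J` is countably generated
and `T` is semisimple (`projective_sup`).

A simple right module occurring in a layer has an annihilator `P` with `R ⧸ P` artinian, and by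
regularity the corresponding isotypic component embeds into `R ⧸ P`. So isotypic components are
finitely generated, and a layer is countably generated exactly when it has countably many of them
(`isCountablyGenerated_rightLayer_iff`). The ring `R ⧸ P` is semisimple on both sides, so each layer
is, also as a left module, a sum of finitely generated semisimple modules indexed by the isotypic
components (`exists_iSup_eq_top_leftLayer`). This makes the argument below work on both sides without
comparing the left and right socle sequences.

If `σ` is countable and the proper layers are countably generated, the filtration induced on a one-sided ideal `K` shows
that `K = J ⊔ T` with `J` countably generated and `T` contained in the socle, so that `K` is
projective (`projective_of_filtration`).

Conversely, let `R` be right hereditary with countably generated socle `S 1`. The left annihilator of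
`S 1` is zero (`eq_zero_of_mul_socleSeq_one`). In a dual basis of a right ideal `I` only countably
many coordinate functions are nonzero on the countably generated module `I ⊓ S 1`, and those that
vanish there vanish identically. Hence every right ideal is countably generated
(`IsRightHereditary.isCountablyGenerated`), in particular every `S α`. As the socle sequence is
strictly increasing, `S ω₁` could not be countably generated if `ω₁ ≤ σ`
(`card_le_aleph0_of_isCountablyGenerated`).
-/

namespace SemiartinianRing

/-! ### Countably generated modules -/

section Modules

variable {A : Type v} [Ring A] {M N : Type u} [AddCommGroup M] [Module A M]
  [AddCommGroup N] [Module A N]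

theorem isCountablyGenerated_iff_submodule {K : Submodule A M} :
    IsCountablyGenerated A K ↔ ∃ s : Set M, s.Countable ∧ Submodule.span A s = K := by
  constructor
  · rintro ⟨s, hs, h⟩
    refine ⟨K.subtype '' s, hs.image _, ?_⟩
    rw [Submodule.span_image, h, Submodule.map_top, Submodule.range_subtype]
  · rintro ⟨s, hs, rfl⟩
    exact ⟨_, hs.preimage Subtype.val_injective, Submodule.span_span_coe_preimage⟩

theorem IsCountablyGenerated.of_surjective (h : IsCountablyGenerated A M) (f : M →ₗ[A] N)
    (hf : Function.Surjective f) : IsCountablyGenerated A N := by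
  obtain ⟨s, hs, h⟩ := h
  refine ⟨f '' s, hs.image _, ?_⟩
  rw [Submodule.span_image, h, Submodule.map_top, LinearMap.range_eq_top.2 hf]

theorem IsCountablyGenerated.of_finite [Module.Finite A M] : IsCountablyGenerated A M := by
  obtain ⟨s, hs⟩ := Module.Finite.fg_top (R := A) (M := M)
  exact ⟨s, s.countable_toSet, hs⟩

theorem IsCountablyGenerated.submodule [IsSemisimpleModule A M] (h : IsCountablyGenerated A M)
    (K : Submodule A M) : IsCountablyGenerated A K := by
  obtain ⟨C, hC⟩ := exists_isCompl K
  exact h.of_surjective (K.projectionOnto C hC) (Submodule.projectionOnto_surjective hC)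

theorem IsCountablyGenerated.of_iSup_eq_top {ι : Type*} [Countable ι] {K : ι → Submodule A M}
    (hK : ∀ i, IsCountablyGenerated A (K i)) (h : ⨆ i, K i = ⊤) : IsCountablyGenerated A M := by
  choose s hs hsK using fun i => isCountablyGenerated_iff_submodule.1 (hK i)
  refine ⟨⋃ i, s i, Set.countable_iUnion hs, ?_⟩
  rw [Submodule.span_iUnion, ← h]
  simp only [hsK]

/-- A semisimple module is the direct sum of its isotypic components, so a countable generating set
can only meet countably many of them. -/
theorem isCountablyGenerated_iff_isotypicComponents [IsSemisimpleModule A M]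
    (hfin : ∀ c ∈ isotypicComponents A M, Module.Finite A c) :
    IsCountablyGenerated A M ↔ #(isotypicComponents A M) ≤ ℵ₀ := by
  have htop : sSup (isotypicComponents A M) = ⊤ := sSup_isotypicComponents A M
  rw [Cardinal.le_aleph0_iff_set_countable]
  constructor
  · rintro ⟨s, hs, hspan⟩
    have key : ∀ x : M, ∃ F : Finset (isotypicComponents A M),
        x ∈ ⨆ c ∈ F, (c : Submodule A M) := by
      intro x
      have hx : x ∈ ⨆ c : isotypicComponents A M, (c : Submodule A M) := by
        rw [← sSup_eq_iSup', htop]; trivial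
      exact Submodule.mem_iSup_iff_exists_finset.1 hx
    choose F hF using key
    refine (hs.biUnion fun x _ => ((F x).countable_toSet.image Subtype.val)).mono
      (s₁ := isotypicComponents A M) fun c hc => ?_
    by_contra hcF
    simp only [Set.mem_iUnion, not_exists] at hcF
    have hle : (⊤ : Submodule A M) ≤ sSup (isotypicComponents A M \ {c}) := by
      rw [← hspan, Submodule.span_le]
      intro x hx
      refine (iSup₂_le fun d hd => ?_ :
        ⨆ d ∈ F x, (d : Submodule A M) ≤ sSup (isotypicComponents A M \ {c})) (hF x)
      refine le_sSup ⟨d.2, fun hdc => hcF x hx ⟨d, hd, hdc⟩⟩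
    have hdis := (sSupIndep_isotypicComponents A M) hc
    rw [eq_top_iff.2 hle, disjoint_top] at hdis
    exact (bot_lt_isotypicComponents hc).ne' hdis
  · intro hc
    have := hc.to_subtype
    refine IsCountablyGenerated.of_iSup_eq_top (K := fun c : isotypicComponents A M => c.1)
      (fun c => ?_) (by rw [← sSup_eq_iSup', htop])
    have := hfin c.1 c.2
    exact .of_finite

end Modules

/-! ### Modules whose cyclic submodules are direct summands -/

section RegularModules

variable {A : Type v} [Ring A] {M : Type u} [AddCommGroup M] [Module A M]

theorem isComplemented_sup_span_singleton (hM : ∀ x : M, IsComplemented (Submodule.span A {x}))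
    {K : Submodule A M} (hK : IsComplemented K) (x : M) :
    IsComplemented (K ⊔ Submodule.span A {x}) := by
  obtain ⟨C, hC⟩ := hK
  -- `x` may be replaced by its component `y` in the complement `C` of `K`.
  set y := C.projection K hC.symm x with hy
  have hyC : y ∈ C := Submodule.projection_apply_mem hC.symm x
  have hxy : x - y ∈ K := by
    have h := Submodule.projection_add_projection_eq_self hC x
    rw [← hy] at h
    rw [← eq_sub_of_add_eq h]
    exact Submodule.projection_apply_mem hC x
  have hsup : K ⊔ Submodule.span A {x} = K ⊔ Submodule.span A {y} := by
    apply le_antisymm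
    · refine sup_le le_sup_left ((Submodule.span_singleton_le_iff_mem _ _).2 ?_)
      rw [← sub_add_cancel x y]
      exact add_mem (Submodule.mem_sup_left hxy)
        (Submodule.mem_sup_right (Submodule.mem_span_singleton_self y))
    · refine sup_le le_sup_left ((Submodule.span_singleton_le_iff_mem _ _).2 ?_)
      rw [← sub_sub_cancel x y]
      exact sub_mem (Submodule.mem_sup_right (Submodule.mem_span_singleton_self x))
        (Submodule.mem_sup_left hxy)
  rw [hsup]
  have hyle : Submodule.span A {y} ≤ C := (Submodule.span_singleton_le_iff_mem _ _).2 hyC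
  obtain ⟨D, hD⟩ := hM y
  -- The modular law splits `C` as the span of `y` plus `D ⊓ C`.
  have hmod : Submodule.span A {y} ⊔ D ⊓ C = C := by
    rw [← sup_inf_assoc_of_le D hyle, hD.sup_eq_top, top_inf_eq]
  refine ⟨D ⊓ C, ?_, ?_⟩
  · refine Disjoint.disjoint_sup_left_of_disjoint_sup_right
      (hD.disjoint.mono_right inf_le_left) ?_
    rw [hmod]
    exact hC.disjoint
  · rw [codisjoint_iff, sup_assoc, hmod, hC.sup_eq_top]

theorem isComplemented_of_fg (hM : ∀ x : M, IsComplemented (Submodule.span A {x}))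
    {K : Submodule A M} (hK : K.FG) : IsComplemented K := by
  obtain ⟨s, hs, rfl⟩ := Submodule.fg_def.1 hK
  induction s, hs using Set.Finite.induction_on with
  | empty => simpa using isComplemented_bot
  | insert _ _ ih =>
    rw [Submodule.span_insert, sup_comm]
    exact isComplemented_sup_span_singleton hM (ih (Submodule.fg_span ‹_›)) _

/-- If the submodule is the union of an ascending chain of finitely generated submodules, with
projections `e 0 = 0, e 1, e 2, …` onto the members of the chain, then `x = ∑ (e (n + 1) - e n) x`
with only finitely many nonzero terms, which splits the submodule off `ℕ →₀ M`. -/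
theorem projective_of_isCountablyGenerated [Module.Projective A M]
    (hM : ∀ x : M, IsComplemented (Submodule.span A {x}))
    {K : Submodule A M} (hK : IsCountablyGenerated A K) : Module.Projective A K := by
  obtain ⟨s, hs, rfl⟩ := isCountablyGenerated_iff_submodule.1 hK
  obtain ⟨f, hf⟩ := (hs.insert 0).exists_eq_range (Set.insert_nonempty _ _)
  set K := Submodule.span A s with hKdef
  have hspan : Submodule.span A (Set.range f) = K := by
    rw [← hf, Submodule.span_insert_zero]
  let L : ℕ → Submodule A M := fun n => Submodule.span A (f '' Set.Iio n)
  have hLmono : Monotone L := fun m n h =>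
    Submodule.span_mono (Set.image_mono (Set.Iio_subset_Iio h))
  have hLK : ∀ n, L n ≤ K := fun n => by
    rw [← hspan]; exact Submodule.span_mono (Set.image_subset_range _ _)
  have hLex : ∀ x ∈ K, ∃ n, x ∈ L n := by
    intro x hx
    have hle : K ≤ ⨆ n, L n := by
      rw [← hspan, Submodule.span_le]
      rintro _ ⟨n, rfl⟩
      exact (le_iSup L (n + 1)) (Submodule.subset_span ⟨n, Nat.lt_succ_self n, rfl⟩)
    exact (Submodule.mem_iSup_of_directed L hLmono.directed_le).1 (hle hx)
  choose C hC using fun n => isComplemented_of_fg hM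
    (Submodule.fg_span ((Set.finite_Iio n).image f) : (L n).FG)
  let e : ℕ → M →ₗ[A] M := fun n => (L n).projection (C n) (hC n)
  have he_mem : ∀ n x, e n x ∈ L n := fun n x => Submodule.projection_apply_mem (hC n) x
  have he_of_mem : ∀ n x, x ∈ L n → e n x = x := fun n x hx =>
    Submodule.projection_apply_of_mem_left (hC n) hx
  let d : ℕ → M →ₗ[A] M := fun n => e (n + 1) - e n
  have hd_mem : ∀ n x, d n x ∈ L (n + 1) := fun n x =>
    sub_mem (he_mem _ _) (hLmono (Nat.le_succ n) (he_mem _ _))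
  have hd_zero : ∀ m n x, x ∈ L m → m ≤ n → d n x = 0 := fun m n x hx hmn => by
    simp only [d, LinearMap.sub_apply]
    rw [he_of_mem _ _ (hLmono hmn hx), he_of_mem _ _ (hLmono (hmn.trans (Nat.le_succ n)) hx),
      sub_self]
  have hd_supp : ∀ m x, x ∈ L m → Function.support (fun n => d n x) ⊆ Finset.range m :=
    fun m x hx n hn => by
      rw [Finset.coe_range, Set.mem_Iio]
      by_contra h
      exact hn (hd_zero m n x hx (not_lt.1 h))
  have hd_fin : ∀ x : K, (Function.support (fun n => d n x)).Finite := fun x => by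
    obtain ⟨m, hm⟩ := hLex x x.2
    exact (Finset.finite_toSet _).subset (hd_supp m x hm)
  let i : K →ₗ[A] (ℕ →₀ M) :=
    { toFun := fun x => Finsupp.ofSupportFinite _ (hd_fin x)
      map_add' := fun x y => by ext n; exact map_add (d n) _ _
      map_smul' := fun a x => by ext n; exact map_smul (d n) _ _ }
  let r : (ℕ →₀ M) →ₗ[A] K := Finsupp.lsum ℕ fun n =>
    (e (n + 1)).codRestrict K fun x => hLK _ (he_mem _ x)
  have : Module.Projective A (ℕ →₀ M) := by
    classical exact Module.Projective.of_equiv' (finsuppLequivDFinsupp A).symm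
  refine Module.Projective.of_split i r ?_
  ext x
  obtain ⟨m, hm⟩ := hLex x x.2
  have hsum : r (i x) = ∑ n ∈ Finset.range m,
      (e (n + 1)).codRestrict K (fun x => hLK _ (he_mem _ x)) (d n x) := by
    simp only [r, Finsupp.lsum_apply]
    refine Finsupp.sum_of_support_subset (i x) (fun n hn => ?_) _ (fun _ _ => map_zero _)
    exact hd_supp m x hm (Finsupp.mem_support_iff.1 hn)
  rw [LinearMap.comp_apply, hsum, LinearMap.id_apply, AddSubmonoidClass.coe_finsetSum]
  have hterm : ∀ n ∈ Finset.range m,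
      (((e (n + 1)).codRestrict K (fun x => hLK _ (he_mem _ x)) (d n x) : K) : M)
        = e (n + 1) x - e n x := fun n _ => by
    rw [LinearMap.codRestrict_apply, he_of_mem _ _ (hd_mem n x)]
    rfl
  rw [Finset.sum_congr rfl hterm, Finset.sum_range_sub fun n => e n (x : M), he_of_mem m _ hm]
  have h0 : e 0 (x : M) = 0 := by
    have := he_mem 0 (x : M)
    simpa [L] using this
  rw [h0, sub_zero]

theorem projective_of_isSemisimpleModule [Module.Projective A M]
    (hM : ∀ x : M, IsComplemented (Submodule.span A {x}))
    (K : Submodule A M) [IsSemisimpleModule A K] : Module.Projective A K := by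
  obtain ⟨s, e, -, hs⟩ := IsSemisimpleModule.exists_linearEquiv_dfinsupp A K
  have hproj : ∀ c : s, Module.Projective A c := fun c => by
    have := hs c
    let g := Submodule.equivMapOfInjective K.subtype K.injective_subtype c.1
    have hcg : IsCountablyGenerated A (c.1.map K.subtype) :=
      (IsCountablyGenerated.of_finite (A := A) (M := c)).of_surjective g.toLinearMap g.surjective
    have := projective_of_isCountablyGenerated hM hcg
    exact Module.Projective.of_equiv' g.symm
  exact Module.Projective.of_equiv' e.symm

theorem projective_sup [Module.Projective A M]
    (hM : ∀ x : M, IsComplemented (Submodule.span A {x}))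
    {J T : Submodule A M} (hJ : IsCountablyGenerated A J) [IsSemisimpleModule A T] :
    Module.Projective A ↥(J ⊔ T) := by
  -- Replace `T` by a complement `T'` of `J ⊓ T` in `T`.
  obtain ⟨C, hC⟩ := exists_isCompl (J.submoduleOf T)
  set T' := C.map T.subtype with hT'
  have hT'T : T' ≤ T := Submodule.map_subtype_le T C
  have hJT : J ⊓ T ⊔ T' = T := by
    have := congrArg (Submodule.map T.subtype) hC.sup_eq_top
    rwa [Submodule.map_sup, Submodule.submoduleOf, Submodule.map_comap_subtype,
      Submodule.map_subtype_top, inf_comm] at this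
  have hdis : Disjoint J T' := by
    rw [Submodule.disjoint_def]
    rintro x hxJ ⟨y, hyC, rfl⟩
    have : y ∈ J.submoduleOf T ⊓ C := ⟨hxJ, hyC⟩
    rw [hC.inf_eq_bot, Submodule.mem_bot] at this
    rw [this, map_zero]
  have hsup : J ⊔ T = J ⊔ T' := by
    conv_lhs => rw [← hJT, ← sup_assoc, sup_inf_self]
  have : IsSemisimpleModule A T' :=
    IsSemisimpleModule.of_injective _ (Submodule.inclusion_injective hT'T)
  have := projective_of_isCountablyGenerated hM hJ
  have := projective_of_isSemisimpleModule hM T'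
  rw [hsup]
  let g : (J × T') →ₗ[A] ↥(J ⊔ T') :=
    (Submodule.inclusion le_sup_left).coprod (Submodule.inclusion le_sup_right)
  refine Module.Projective.of_equiv' (LinearEquiv.ofBijective g ⟨?_, ?_⟩)
  · rw [injective_iff_map_eq_zero]
    rintro ⟨x, y⟩ hxy
    have h : (x : M) + y = 0 := congrArg Subtype.val hxy
    have hx : (x : M) ∈ T' := by
      rw [eq_neg_of_add_eq_zero_left h]; exact neg_mem y.2
    have hx0 := (Submodule.disjoint_def.1 hdis) x x.2 hx
    rw [hx0, zero_add] at h
    exact Prod.ext (Subtype.ext hx0) (Subtype.ext h)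
  · rintro ⟨z, hz⟩
    obtain ⟨x, hx, y, hy, rfl⟩ := Submodule.mem_sup.1 hz
    exact ⟨(⟨x, hx⟩, ⟨y, hy⟩), rfl⟩

end RegularModules

end SemiartinianRing

namespace SemiartinianRing

/-! ### Filtrations with countably generated semisimple layers -/

section Filtrations

universe w

variable {A : Type v} [Ring A] {M : Type u} [AddCommGroup M] [Module A M]

theorem countable_Iic_of_card_le {σ : Ordinal.{w}} (hσ : σ.card ≤ ℵ₀) : (Set.Iic σ).Countable := by
  rw [← Cardinal.le_aleph0_iff_set_countable, ← Order.Iio_succ, Cardinal.mk_Iio_ordinal,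
    Cardinal.lift_le_aleph0]
  rw [Order.succ_eq_add_one, Ordinal.card_add_one]
  exact Cardinal.add_le_aleph0.2 ⟨hσ, Cardinal.one_le_aleph0⟩

theorem exists_countable_inf_le_span_sup (K P Q : Submodule A M)
    [IsSemisimpleModule A (P ⧸ Q.submoduleOf P)]
    (h : IsCountablyGenerated A (P ⧸ Q.submoduleOf P)) :
    ∃ s : Set M, s.Countable ∧ s ⊆ K ∧ K ⊓ P ≤ Submodule.span A s ⊔ Q := by
  set π := (Q.submoduleOf P).mkQ
  obtain ⟨t, ht, hspan⟩ :=
    isCountablyGenerated_iff_submodule.1 (h.submodule ((K.submoduleOf P).map π))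
  have hlift : ∀ y : t, ∃ x : P, (x : M) ∈ K ∧ π x = y := by
    rintro ⟨y, hy⟩
    have : y ∈ (K.submoduleOf P).map π := by rw [← hspan]; exact Submodule.subset_span hy
    obtain ⟨x, hx, rfl⟩ := this
    exact ⟨x, hx, rfl⟩
  choose g hgK hg using hlift
  have := ht.to_subtype
  refine ⟨Set.range fun y => (g y : M), Set.countable_range _, ?_, ?_⟩
  · rintro _ ⟨y, rfl⟩
    exact hgK y
  · rintro x ⟨hxK, hxP⟩
    have hmem : π ⟨x, hxP⟩ ∈ Submodule.span A (π '' Set.range g) := by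
      have ht' : π '' Set.range g = t := by
        rw [← Set.range_comp, show π ∘ g = Subtype.val from funext hg, Subtype.range_val]
      rw [ht', hspan]
      exact ⟨⟨x, hxP⟩, hxK, rfl⟩
    rw [Submodule.span_image] at hmem
    obtain ⟨z, hz, hzx⟩ := hmem
    have hdiff : x - z ∈ Q := by
      have : (⟨x, hxP⟩ - z : P) ∈ Q.submoduleOf P := by
        rw [← Submodule.ker_mkQ (Q.submoduleOf P), LinearMap.mem_ker, map_sub, sub_eq_zero]
        exact hzx.symm
      exact this
    have hzs : (z : M) ∈ Submodule.span A (Set.range fun y => (g y : M)) := by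
      have := Submodule.mem_map_of_mem (f := P.subtype) hz
      rwa [← Submodule.span_image, ← Set.range_comp] at this
    rw [← add_sub_cancel (z : M) x]
    exact add_mem (Submodule.mem_sup_left hzs) (Submodule.mem_sup_right hdiff)

/-- The filtration induced on a submodule `K` shows that `K` is the sum of a countably generated
submodule and of the semisimple module `T 1 ⊓ K`; the layer `T 1 / T 0` may be arbitrarily large. -/
theorem projective_of_filtration [Module.Projective A M] [Module.Finite A M]
    (hM : ∀ x : M, IsComplemented (Submodule.span A {x}))
    {σ : Ordinal.{w}} (hσ : σ.card ≤ ℵ₀) (T : Ordinal.{w} → Submodule A M) (h0 : T 0 = ⊥)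
    (hlim : ∀ α, Order.IsSuccLimit α → ∀ x ∈ T α, ∃ β < α, x ∈ T β) (htop : T (σ + 1) = ⊤)
    (hss : ∀ α ≤ σ, IsSemisimpleModule A (T (α + 1) ⧸ (T α).submoduleOf (T (α + 1))))
    (hcg : ∀ α, 0 < α → α < σ → IsCountablyGenerated A (T (α + 1) ⧸ (T α).submoduleOf (T (α + 1))))
    (K : Submodule A M) : Module.Projective A K := by
  -- The top layer is a factor of the finitely generated module `M`.
  have hcg_top : ∀ α ≤ σ, 0 < α →
      IsCountablyGenerated A (T (α + 1) ⧸ (T α).submoduleOf (T (α + 1))) := by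
    intro α hα hpos
    rcases hα.lt_or_eq with hlt | rfl
    · exact hcg α hpos hlt
    · have h : IsCountablyGenerated A (T (α + 1)) := by
        rw [htop]
        exact (IsCountablyGenerated.of_finite (A := A) (M := M)).of_surjective
          Submodule.topEquiv.symm.toLinearMap Submodule.topEquiv.symm.surjective
      exact h.of_surjective _ (Submodule.mkQ_surjective _)
  have hX : ∀ α : Ordinal.{w}, ∃ s : Set M, s.Countable ∧ s ⊆ K ∧
      (α ≤ σ → 0 < α → K ⊓ T (α + 1) ≤ Submodule.span A s ⊔ T α) := by
    intro α
    by_cases h : α ≤ σ ∧ 0 < α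
    · have := hss α h.1
      obtain ⟨s, hs, hsK, hle⟩ := exists_countable_inf_le_span_sup K _ _ (hcg_top α h.1 h.2)
      exact ⟨s, hs, hsK, fun _ _ => hle⟩
    · exact ⟨∅, Set.countable_empty, Set.empty_subset _, fun h1 h2 => (h ⟨h1, h2⟩).elim⟩
  choose X hXc hXK hX using hX
  set J := Submodule.span A (⋃ α ∈ Set.Iic σ, X α) with hJ
  have hJK : J ≤ K := Submodule.span_le.2 (Set.iUnion₂_subset fun α _ => hXK α)
  have hJcg : IsCountablyGenerated A J := isCountablyGenerated_iff_submodule.2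
    ⟨_, (countable_Iic_of_card_le hσ).biUnion fun α _ => hXc α, rfl⟩
  have hind : ∀ α ≤ σ + 1, K ⊓ T α ≤ J ⊔ T 1 ⊓ K := by
    intro α
    induction α using Ordinal.limitRecOn with
    | zero => intro; rw [h0, inf_bot_eq]; exact bot_le
    | add_one α ih =>
      intro hα
      have hα' : α ≤ σ := by
        rw [← Order.succ_eq_add_one, ← Order.succ_eq_add_one] at hα
        exact Order.succ_le_succ_iff.1 hα
      rcases eq_or_ne α 0 with rfl | hne
      · rw [zero_add, inf_comm]; exact le_sup_right
      · intro x hx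
        obtain ⟨y, hy, z, hz, rfl⟩ :=
          Submodule.mem_sup.1 (hX α hα' (pos_iff_ne_zero.2 hne) hx)
        have hyJ : y ∈ J :=
          Submodule.span_mono (Set.subset_biUnion_of_mem (u := X) (Set.mem_Iic.2 hα')) hy
        have hzK : z ∈ K := by
          have := sub_mem hx.1 (hJK hyJ)
          rwa [add_sub_cancel_left] at this
        exact add_mem (Submodule.mem_sup_left hyJ)
          (ih (hα'.trans (Order.le_succ σ)) ⟨hzK, hz⟩)
    | limit α hα ih =>
      rintro hασ x ⟨hxK, hx⟩
      obtain ⟨β, hβ, hxβ⟩ := hlim α hα x hx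
      exact ih β hβ (hβ.le.trans hασ) ⟨hxK, hxβ⟩
  have hK : J ⊔ T 1 ⊓ K = K := by
    refine le_antisymm (sup_le hJK inf_le_right) ?_
    have := hind (σ + 1) le_rfl
    rwa [htop, inf_top_eq] at this
  have hss1 : IsSemisimpleModule A (T 1) := by
    have h := hss 0 bot_le
    rw [zero_add] at h
    refine IsSemisimpleModule.of_injective ((T 0).submoduleOf (T 1)).mkQ ?_
    rw [← LinearMap.ker_eq_bot, Submodule.ker_mkQ, h0, Submodule.submoduleOf,
      Submodule.comap_bot, Submodule.ker_subtype]
  have : IsSemisimpleModule A ↥(T 1 ⊓ K) :=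
    IsSemisimpleModule.of_injective _ (Submodule.inclusion_injective inf_le_left)
  rw [← hK]
  exact projective_sup hM hJcg

end Filtrations

/-! ### The socle sequence -/

section Socle

variable (A : Type v) [Ring A] (M : Type u) [AddCommGroup M] [Module A M]

instance : IsSemisimpleModule A (socle A M) := by
  rw [socle, sSup_eq_iSup]
  exact isSemisimpleModule_biSup_of_isSemisimpleModule_submodule fun N hN =>
    have : IsSimpleModule A N := hN
    inferInstance

variable {A M}

theorem le_socle_of_isSemisimpleModule (K : Submodule A M) [IsSemisimpleModule A K] :
    K ≤ socle A M := by
  have h := congrArg (Submodule.map K.subtype) (IsSemisimpleModule.sSup_simples_eq_top A K)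
  simp only [sSup_eq_iSup, Submodule.map_iSup, Submodule.map_subtype_top] at h
  rw [← h]
  refine iSup₂_le fun N hN => le_sSup ?_
  have : IsSimpleModule A N := hN
  exact IsSimpleModule.congr
    (Submodule.equivMapOfInjective K.subtype K.injective_subtype N).symm

theorem map_socle_le {N : Type u} [AddCommGroup N] [Module A N] (f : M →ₗ[A] N) :
    (socle A M).map f ≤ socle A N := by
  have h : IsSemisimpleModule A ((socle A M).map f) := by
    rw [← LinearMap.range_domRestrict]
    exact .range _
  exact le_socle_of_isSemisimpleModule _

theorem le_socleStep (N : Submodule A M) : N ≤ socleStep A M N := by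
  intro x hx
  rw [socleStep, Submodule.mem_comap, Submodule.mkQ_apply, (Submodule.Quotient.mk_eq_zero N).2 hx]
  exact zero_mem _

variable (A M)

theorem socleSeq_zero : socleSeq A M 0 = ⊥ :=
  transfiniteIterate_bot _ _

theorem socleSeq_add_one (α : Ordinal.{u}) :
    socleSeq A M (α + 1) = socleStep A M (socleSeq A M α) :=
  transfiniteIterate_succ _ _ _ (not_isMax α)

theorem socleSeq_mono : Monotone (socleSeq A M) :=
  monotone_transfiniteIterate _ _ le_socleStep

variable {A M}

theorem exists_mem_socleSeq_of_isSuccLimit {α : Ordinal.{u}} (hα : Order.IsSuccLimit α) {x : M}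
    (hx : x ∈ socleSeq A M α) : ∃ β < α, x ∈ socleSeq A M β := by
  rw [socleSeq, transfiniteIterate_limit _ _ _ hα] at hx
  have : Nonempty (Set.Iio α) := ⟨⟨0, pos_iff_ne_zero.2 hα.ne_bot⟩⟩
  have hdir : Directed (· ≤ ·) fun β : Set.Iio α => transfiniteIterate (socleStep A M) β.1 ⊥ :=
    Monotone.directed_le fun β γ h => socleSeq_mono A M h
  obtain ⟨β, hβ⟩ := (Submodule.mem_iSup_of_directed _ hdir).1 hx
  exact ⟨β.1, β.2, hβ⟩

instance (α : Ordinal.{u}) : IsSemisimpleModule A (Layer A M α) := by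
  let f : Layer A M α →ₗ[A] M ⧸ socleSeq A M α :=
    Submodule.mapQ _ _ (socleSeq A M (α + 1)).subtype le_rfl
  have hf : ∀ x, f x ∈ socle A (M ⧸ socleSeq A M α) := by
    intro x
    obtain ⟨⟨x, hx⟩, rfl⟩ := Submodule.Quotient.mk_surjective _ x
    rw [socleSeq_add_one] at hx
    exact hx
  refine IsSemisimpleModule.of_injective (f.codRestrict _ hf) ?_
  rw [LinearMap.injective_codRestrict_iff, ← LinearMap.ker_eq_bot]
  exact Submodule.ker_liftQ_eq_bot _ _ _ (by
    rw [LinearMap.ker_comp, Submodule.ker_mkQ]; rfl)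

theorem map_socleSeq_le (f : M →ₗ[A] M) (α : Ordinal.{u}) :
    ∀ x ∈ socleSeq A M α, f x ∈ socleSeq A M α := by
  induction α using Ordinal.limitRecOn with
  | zero =>
    intro x hx
    rw [socleSeq_zero, Submodule.mem_bot] at hx ⊢
    rw [hx, map_zero]
  | add_one α ih =>
    intro x hx
    rw [socleSeq_add_one] at hx ⊢
    exact map_socle_le (Submodule.mapQ _ _ f ih) ⟨_, hx, rfl⟩
  | limit α hα ih =>
    intro x hx
    obtain ⟨β, hβ, hxβ⟩ := exists_mem_socleSeq_of_isSuccLimit hα hx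
    exact socleSeq_mono A M hβ.le (ih β hβ x hxβ)

theorem socleSeq_loewyLength (h : loewyLength A M ≠ 0) :
    socleSeq A M (loewyLength A M) = ⊤ := by
  have hne : {α | socleSeq A M α = ⊤}.Nonempty := by
    by_contra hne
    rw [Set.not_nonempty_iff_eq_empty] at hne
    exact h (by rw [loewyLength, hne, Ordinal.sInf_empty])
  exact csInf_mem hne

theorem socleSeq_add_one_eq_top {σ : Ordinal.{u}} (hσ : loewyLength A M = σ + 1) :
    socleSeq A M (σ + 1) = ⊤ := by
  rw [← hσ]
  exact socleSeq_loewyLength (by rw [hσ, ← Order.succ_eq_add_one]; exact Order.succ_ne_bot σ)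

theorem socleSeq_lt_add_one {α : Ordinal.{u}} (hα : α < loewyLength A M) :
    socleSeq A M α < socleSeq A M (α + 1) := by
  refine lt_of_le_of_ne (socleSeq_mono A M (Order.le_succ α)) fun heq => ?_
  have hconst : ∀ β, α ≤ β → socleSeq A M β = socleSeq A M α := by
    intro β
    induction β using Ordinal.limitRecOn with
    | zero => intro h; rw [le_zero_iff.1 h]
    | add_one β ih =>
      intro h
      rcases h.lt_or_eq with h | rfl
      · rw [socleSeq_add_one, ih (Order.lt_succ_iff.1 h), ← socleSeq_add_one, heq]
      · rfl
    | limit β hβ ih =>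
      intro h
      refine le_antisymm (fun x hx => ?_) (socleSeq_mono A M h)
      obtain ⟨γ, hγ, hx⟩ := exists_mem_socleSeq_of_isSuccLimit hβ hx
      rcases le_total α γ with h' | h'
      · rwa [ih γ hγ h'] at hx
      · exact socleSeq_mono A M h' hx
  have htop := socleSeq_loewyLength (A := A) (M := M) (pos_of_gt hα).ne'
  rw [hconst _ hα.le] at htop
  exact hα.not_ge (csInf_le' htop)

/-- A submodule `S (ω₁)` generated by a countable set would already be contained in some `S β` with
`β` countable, because countable sets of countable ordinals are bounded. -/
theorem card_le_aleph0_of_isCountablyGenerated {σ : Ordinal.{u}} (hσ : loewyLength A M = σ + 1)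
    (h : ∀ α, IsCountablyGenerated A (socleSeq A M α)) : σ.card ≤ ℵ₀ := by
  by_contra hlt
  have hω : Ordinal.omega 1 ≤ σ := by
    rw [← Cardinal.ord_aleph, Cardinal.ord_le, ← Cardinal.succ_aleph0]
    exact Order.succ_le_of_lt (not_le.1 hlt)
  have hlim : Order.IsSuccLimit (Ordinal.omega.{u} 1) := Cardinal.isSuccLimit_omega 1
  obtain ⟨s, hs, hspan⟩ := isCountablyGenerated_iff_submodule.1 (h (Ordinal.omega 1))
  have hmem : ∀ x : s, ∃ β < Ordinal.omega.{u} 1, (x : M) ∈ socleSeq A M β := fun x =>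
    exists_mem_socleSeq_of_isSuccLimit hlim (by rw [← hspan]; exact Submodule.subset_span x.2)
  choose b hb hxb using hmem
  have := hs.to_subtype
  have hsup : ⨆ x, b x < Ordinal.omega 1 := Ordinal.iSup_lt_omega_one hb
  have hle : socleSeq A M (Ordinal.omega 1) ≤ socleSeq A M (⨆ x, b x) := by
    rw [← hspan, Submodule.span_le]
    intro x hx
    exact socleSeq_mono A M (Ordinal.le_iSup b ⟨x, hx⟩) (hxb ⟨x, hx⟩)
  have hltl : ⨆ x, b x < loewyLength A M := by
    rw [hσ]; exact (hsup.trans_le hω).trans (Order.lt_succ σ)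
  refine (socleSeq_lt_add_one hltl).not_ge ((socleSeq_mono A M ?_).trans hle)
  exact (hlim.succ_lt hsup).le

end Socle

end SemiartinianRing

namespace SemiartinianRing

open MulOpposite

/-! ### Von Neumann regular rings and their primitive factors -/

section Regular

theorem isComplemented_of_idempotent_endomorphism {A M : Type*} [Ring A] [AddCommGroup M]
    [Module A M] {K : Submodule A M} (f : M →ₗ[A] M) (hf : ∀ x, f x ∈ K)
    (hfK : ∀ x ∈ K, f x = x) : IsComplemented K :=
  ⟨_, LinearMap.isCompl_of_proj (f := f.codRestrict K hf) fun x => Subtype.ext (hfK x x.2)⟩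

variable {R : Type u} [Ring R]

/-- `R`, as a right module over itself, is free on one generator. -/
def rightRegularEquiv (R : Type u) [Ring R] : Rᵐᵒᵖ ≃ₗ[Rᵐᵒᵖ] R where
  toFun := unop
  invFun := op
  map_add' _ _ := rfl
  map_smul' _ _ := rfl
  left_inv _ := rfl
  right_inv _ := rfl

instance : Module.Projective Rᵐᵒᵖ R := Module.Projective.of_equiv' (rightRegularEquiv R)

instance : Module.Finite Rᵐᵒᵖ R := Module.Finite.equiv (rightRegularEquiv R)

theorem IsVonNeumannRegular.isComplemented_span_singleton (h : IsVonNeumannRegular R) (x : R) :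
    IsComplemented (Submodule.span R {x}) := by
  obtain ⟨s, hs⟩ := h x
  refine isComplemented_of_idempotent_endomorphism (DistribSMul.toLinearMap R R (op (s * x)))
    (fun y => ?_) fun y hy => ?_
  · exact Submodule.mem_span_singleton.2 ⟨y * s, mul_assoc _ _ _⟩
  · obtain ⟨r, rfl⟩ := Submodule.mem_span_singleton.1 hy
    change r * x * (s * x) = r * x
    rw [mul_assoc, ← mul_assoc x, hs]

theorem IsVonNeumannRegular.isComplemented_span_singleton_right (h : IsVonNeumannRegular R)
    (x : R) : IsComplemented (Submodule.span Rᵐᵒᵖ {x}) := by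
  obtain ⟨s, hs⟩ := h x
  refine isComplemented_of_idempotent_endomorphism (DistribSMul.toLinearMap Rᵐᵒᵖ R (x * s))
    (fun y => ?_) fun y hy => ?_
  · exact Submodule.mem_span_singleton.2 ⟨op (s * y), (mul_assoc x s y).symm⟩
  · obtain ⟨r, rfl⟩ := Submodule.mem_span_singleton.1 hy
    change x * s * (x * r.unop) = x * r.unop
    rw [← mul_assoc, hs]

theorem IsVonNeumannRegular.mulOpposite (h : IsVonNeumannRegular R) :
    IsVonNeumannRegular Rᵐᵒᵖ := by
  intro r
  obtain ⟨s, hs⟩ := h r.unop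
  exact ⟨op s, unop_injective (by simpa [mul_assoc] using hs)⟩

theorem IsVonNeumannRegular.quotient (h : IsVonNeumannRegular R) (P : Ideal R) [P.IsTwoSided] :
    IsVonNeumannRegular (R ⧸ P) := by
  intro r
  obtain ⟨r, rfl⟩ := Ideal.Quotient.mk_surjective r
  obtain ⟨s, hs⟩ := h r
  exact ⟨Ideal.Quotient.mk P s, by rw [← map_mul, ← map_mul, hs]⟩

theorem IsVonNeumannRegular.jacobson_eq_bot (h : IsVonNeumannRegular R) :
    Ring.jacobson R = ⊥ := by
  rw [← Ideal.jacobson_bot, eq_bot_iff]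
  intro x hx
  obtain ⟨s, hs⟩ := h x
  obtain ⟨z, hz⟩ := Ideal.mem_jacobson_iff.1 hx (-s)
  rw [Submodule.mem_bot] at hz ⊢
  -- `z` is a left inverse of `1 - s * x`, which annihilates the idempotent `s * x`.
  have h0 : (z * -s * x + z - 1) * (s * x) = -(s * x) := by
    have : (z * -s * x + z - 1) * (s * x)
        = -(z * s * (x * s * x)) + z * s * x - s * x := by noncomm_ring
    rw [this, hs]; noncomm_ring
  rw [hz, zero_mul, eq_comm, neg_eq_zero] at h0
  rw [← hs, mul_assoc, h0, mul_zero]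

/-- A two-sided ideal, viewed as a right ideal. -/
def toRightIdeal (P : Ideal R) [P.IsTwoSided] : Submodule Rᵐᵒᵖ R where
  toAddSubmonoid := P.toAddSubmonoid
  smul_mem' r _ hx := P.mul_mem_right r.unop hx

theorem isArtinian_quotient_toRightIdeal (P : Ideal R) [P.IsTwoSided]
    (h : IsArtinian (R ⧸ P)ᵐᵒᵖ (R ⧸ P)) : IsArtinian Rᵐᵒᵖ (R ⧸ toRightIdeal P) := by
  let τ : Rᵐᵒᵖ →+* (R ⧸ P)ᵐᵒᵖ := (Ideal.Quotient.mk P).op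
  have hτ : RingHomSurjective τ := ⟨fun x => by
    obtain ⟨r, hr⟩ := Ideal.Quotient.mk_surjective x.unop
    exact ⟨op r, unop_injective hr⟩⟩
  let g : R →ₛₗ[τ] R ⧸ P :=
    { toFun := Ideal.Quotient.mk P
      map_add' := map_add _
      map_smul' := fun r x => map_mul _ x r.unop }
  have hg : LinearMap.ker g = toRightIdeal P :=
    Submodule.ext fun x => Ideal.Quotient.eq_zero_iff_mem
  let f : (R ⧸ toRightIdeal P) →ₛₗ[τ] R ⧸ P := (toRightIdeal P).liftQ g hg.ge
  refine (LinearMap.isArtinian_iff_of_bijective f ⟨?_, ?_⟩).2 h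
  · exact LinearMap.ker_eq_bot.1 (Submodule.ker_liftQ_eq_bot _ _ _ hg.le)
  · intro y
    obtain ⟨r, rfl⟩ := Ideal.Quotient.mk_surjective y
    exact ⟨Submodule.Quotient.mk r, rfl⟩

theorem IsVonNeumannRegular.isSemisimpleModule_quotient (hreg : IsVonNeumannRegular R)
    (P : Ideal R) [P.IsTwoSided] (h : IsArtinian (R ⧸ P)ᵐᵒᵖ (R ⧸ P)) :
    IsSemisimpleModule R (R ⧸ P) := by
  have hart : IsArtinianRing (R ⧸ P)ᵐᵒᵖ := isArtinian_of_linearEquiv (rightRegularEquiv _).symm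
  have hop : IsSemisimpleRing (R ⧸ P)ᵐᵒᵖ :=
    IsArtinianRing.isSemisimpleRing_iff_jacobson.2 (hreg.quotient P).mulOpposite.jacobson_eq_bot
  have hQ : IsSemisimpleRing (R ⧸ P) := isSemisimpleRing_mulOpposite_iff.1 hop
  have hσ : RingHomSurjective (Ideal.Quotient.mk P) := ⟨Ideal.Quotient.mk_surjective⟩
  let f : (R ⧸ P) →ₛₗ[Ideal.Quotient.mk P] R ⧸ P :=
    { toFun := id
      map_add' := fun _ _ => rfl
      map_smul' := fun r x => by
        obtain ⟨x, rfl⟩ := Ideal.Quotient.mk_surjective x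
        rfl }
  exact (LinearMap.isSemisimpleModule_iff_of_bijective f Function.bijective_id).2 hQ

end Regular

/-! ### The layers of a semiartinian regular ring with primitive factors artinian -/

section Layers

variable {R : Type u} [Ring R]

/-- The annihilator of an isotypic component equals that of the simple modules occurring in it. -/
theorem exists_isRightPrimitive_of_mem_isotypicComponents {M : Type u} [AddCommGroup M]
    [Module Rᵐᵒᵖ M] {c : Submodule Rᵐᵒᵖ M} (hc : c ∈ isotypicComponents Rᵐᵒᵖ M) :
    ∃ (P : Ideal R) (_ : P.IsTwoSided), IsRightPrimitive R P ∧
      (∀ m ∈ c, ∀ r ∈ P, op r • m = 0) ∧ ∀ r, (∀ m : M, op r • m = 0) → r ∈ P := by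
  obtain ⟨N, hN, rfl⟩ := hc
  let P : Ideal R :=
    { carrier := {r | ∀ m : N, op r • m = 0}
      add_mem' := fun {a b} ha hb m => by rw [op_add, add_smul, ha, hb, add_zero]
      zero_mem' := fun m => by rw [op_zero, zero_smul]
      smul_mem' := fun a r hr m => by rw [smul_eq_mul, op_mul, mul_smul, hr] }
  have hP : P.IsTwoSided := ⟨fun {a} b ha m => by rw [op_mul, mul_smul, ha, smul_zero]⟩
  refine ⟨P, hP, ⟨N, inferInstance, inferInstance, hN, fun r => Iff.rfl⟩, ?_, ?_⟩
  · intro m hm r hr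
    have hle : isotypicComponent Rᵐᵒᵖ M N ≤
        ⨆ K : {K : Submodule Rᵐᵒᵖ M | Nonempty (K ≃ₗ[Rᵐᵒᵖ] N)}, K.1 := (sSup_eq_iSup' _).le
    refine Submodule.iSup_induction _ (motive := fun m => op r • m = 0) (hle hm) ?_
      (smul_zero _) fun x y hx hy => by rw [smul_add, hx, hy, add_zero]
    rintro ⟨K, ⟨e⟩⟩ x hx
    have : op r • (⟨x, hx⟩ : K) = 0 := e.injective (by rw [map_smul, hr, map_zero])
    exact congrArg Subtype.val this
  · exact fun r hr m => Subtype.ext (hr m)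

theorem mul_mem_socleSeq (α : Ordinal.{u}) (a : R) {x : R} (hx : x ∈ socleSeq Rᵐᵒᵖ R α) :
    a * x ∈ socleSeq Rᵐᵒᵖ R α :=
  map_socleSeq_le (DistribSMul.toLinearMap Rᵐᵒᵖ R a) α x hx

variable (R) in
/-- The members of the right socle sequence of a ring are two-sided ideals; this is the `α`th of
them, viewed as a left ideal. -/
noncomputable def socleIdeal (α : Ordinal.{u}) : Submodule R R where
  toAddSubmonoid := (socleSeq Rᵐᵒᵖ R α).toAddSubmonoid
  smul_mem' a _ hx := mul_mem_socleSeq α a hx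

variable (R) in
/-- The `α`th layer of the right socle sequence, viewed as a left module. -/
abbrev LeftLayer (α : Ordinal.{u}) : Type u :=
  socleIdeal R (α + 1) ⧸ (socleIdeal R α).submoduleOf (socleIdeal R (α + 1))

/-- For every isotypic component `c` of a layer, the annihilator `P` of `c` has `R ⧸ P` artinian.
If `x` represents an element of `c` then `x * P ⊆ S α`, and regularity makes `x ∈ P` imply
`x ∈ S α`; so the part of the layer annihilated by `P` embeds into `R ⧸ P` on both sides. -/
theorem exists_ideal_of_mem_isotypicComponents (hpfa : HasRightPFA R) (α : Ordinal.{u})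
    {c : Submodule Rᵐᵒᵖ (RightLayer R α)} (hc : c ∈ isotypicComponents Rᵐᵒᵖ (RightLayer R α)) :
    ∃ (P : Ideal R) (_ : P.IsTwoSided), IsArtinian (R ⧸ P)ᵐᵒᵖ (R ⧸ P) ∧
      (∀ x : socleSeq Rᵐᵒᵖ R (α + 1), Submodule.Quotient.mk x ∈ c →
        ∀ p ∈ P, (x : R) * p ∈ socleSeq Rᵐᵒᵖ R α) ∧
      ∀ x ∈ socleSeq Rᵐᵒᵖ R α, x ∈ P := by
  obtain ⟨P, hP, hprim, hcP, hP'⟩ := exists_isRightPrimitive_of_mem_isotypicComponents hc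
  refine ⟨P, hP, hpfa P hprim, fun x hx p hp => ?_, fun r hr => hP' r fun m => ?_⟩
  · have := hcP _ hx p hp
    rw [← Submodule.Quotient.mk_smul, Submodule.Quotient.mk_eq_zero] at this
    exact this
  · obtain ⟨x, rfl⟩ := Submodule.Quotient.mk_surjective _ m
    rw [← Submodule.Quotient.mk_smul, Submodule.Quotient.mk_eq_zero]
    exact mul_mem_socleSeq α (x : R) hr

theorem IsVonNeumannRegular.mem_socleSeq (hreg : IsVonNeumannRegular R) {α : Ordinal.{u}}
    {P : Ideal R} {x : R} (hxP : x ∈ P) (h : ∀ p ∈ P, x * p ∈ socleSeq Rᵐᵒᵖ R α) :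
    x ∈ socleSeq Rᵐᵒᵖ R α := by
  obtain ⟨s, hs⟩ := hreg x
  have := h (s * x) (P.mul_mem_left s hxP)
  rwa [← mul_assoc, hs] at this

theorem finite_of_mem_isotypicComponents (hreg : IsVonNeumannRegular R) (hpfa : HasRightPFA R)
    (α : Ordinal.{u}) {c : Submodule Rᵐᵒᵖ (RightLayer R α)}
    (hc : c ∈ isotypicComponents Rᵐᵒᵖ (RightLayer R α)) : Module.Finite Rᵐᵒᵖ c := by
  obtain ⟨P, hP, hart, hcP, hSP⟩ := exists_ideal_of_mem_isotypicComponents hpfa α hc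
  let φ : RightLayer R α →ₗ[Rᵐᵒᵖ] R ⧸ toRightIdeal P :=
    Submodule.mapQ _ _ (socleSeq Rᵐᵒᵖ R (α + 1)).subtype fun x hx => hSP x hx
  have hinj : Function.Injective (φ ∘ₗ c.subtype) := by
    rw [injective_iff_map_eq_zero]
    rintro ⟨y, hy⟩ h0
    obtain ⟨x, rfl⟩ := Submodule.Quotient.mk_surjective _ y
    have hxP : (x : R) ∈ P := (Submodule.Quotient.mk_eq_zero (toRightIdeal P)).1 h0
    refine Subtype.ext ((Submodule.Quotient.mk_eq_zero _).2 ?_)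
    exact hreg.mem_socleSeq hxP (hcP x hy)
  have := isArtinian_quotient_toRightIdeal P hart
  have : IsArtinian Rᵐᵒᵖ c := isArtinian_of_injective _ hinj
  exact (IsSemisimpleModule.finite_tfae.out 0 2).2 this

theorem isCountablyGenerated_rightLayer_iff (hreg : IsVonNeumannRegular R)
    (hpfa : HasRightPFA R) (α : Ordinal.{u}) :
    IsCountablyGenerated Rᵐᵒᵖ (RightLayer R α) ↔ numComponents R α ≤ ℵ₀ :=
  isCountablyGenerated_iff_isotypicComponents fun _ hc =>
    finite_of_mem_isotypicComponents hreg hpfa α hc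

/-- As left modules the layers are still sums of finitely generated semisimple modules, indexed by
the isotypic components of the right module. -/
theorem exists_iSup_eq_top_leftLayer (hreg : IsVonNeumannRegular R) (hpfa : HasRightPFA R)
    (α : Ordinal.{u}) :
    ∃ D : isotypicComponents Rᵐᵒᵖ (RightLayer R α) → Submodule R (LeftLayer R α),
      (∀ c, IsSemisimpleModule R (D c) ∧ Module.Finite R (D c)) ∧ ⨆ c, D c = ⊤ := by
  choose P hP hart hcP hSP using fun c : isotypicComponents Rᵐᵒᵖ (RightLayer R α) =>
    exists_ideal_of_mem_isotypicComponents hpfa α c.2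
  let H : isotypicComponents Rᵐᵒᵖ (RightLayer R α) → Submodule R (socleIdeal R (α + 1)) :=
    fun c =>
    { carrier := {x | ∀ p ∈ P c, (x : R) * p ∈ socleSeq Rᵐᵒᵖ R α}
      add_mem' := fun {x y} hx hy p hp => by
        have := add_mem (hx p hp) (hy p hp)
        rwa [← add_mul] at this
      zero_mem' := fun p _ => by
        rw [ZeroMemClass.coe_zero, zero_mul]; exact zero_mem _
      smul_mem' := fun a x hx p hp => by
        have := mul_mem_socleSeq α a (hx p hp)
        rwa [← mul_assoc] at this }
  let π := ((socleIdeal R α).submoduleOf (socleIdeal R (α + 1))).mkQ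
  refine ⟨fun c => (H c).map π, fun c => ?_, ?_⟩
  · have := hP c
    let ψ : LeftLayer R α →ₗ[R] R ⧸ P c :=
      Submodule.mapQ _ _ (socleIdeal R (α + 1)).subtype fun x hx => hSP c x hx
    have hinj : Function.Injective (ψ ∘ₗ ((H c).map π).subtype) := by
      rw [injective_iff_map_eq_zero]
      rintro ⟨_, x, hx, rfl⟩ h0
      have hxP : (x : R) ∈ P c := (Submodule.Quotient.mk_eq_zero (P c)).1 h0
      refine Subtype.ext ((Submodule.Quotient.mk_eq_zero _).2 ?_)
      exact hreg.mem_socleSeq hxP hx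
    have hss := hreg.isSemisimpleModule_quotient (P c) (hart c)
    have hnoeth : IsNoetherian R (R ⧸ P c) := inferInstance
    have := isNoetherian_of_injective _ hinj
    exact ⟨.of_injective _ hinj, inferInstance⟩
  · rw [eq_top_iff]
    rintro y -
    obtain ⟨x, rfl⟩ := Submodule.Quotient.mk_surjective _ y
    let x' : socleSeq Rᵐᵒᵖ R (α + 1) := ⟨x, x.2⟩
    have hx' : (Submodule.Quotient.mk x' : RightLayer R α) ∈
        ⨆ c : isotypicComponents Rᵐᵒᵖ (RightLayer R α), c.1 := by
      rw [← sSup_eq_iSup', sSup_isotypicComponents]; trivial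
    have key : ∃ z : socleSeq Rᵐᵒᵖ R (α + 1),
        (Submodule.Quotient.mk z : RightLayer R α) = Submodule.Quotient.mk x' ∧
          π ⟨z, z.2⟩ ∈ ⨆ c, (H c).map π := by
      refine Submodule.iSup_induction _ (motive := fun y => ∃ z : socleSeq Rᵐᵒᵖ R (α + 1),
        (Submodule.Quotient.mk z : RightLayer R α) = y ∧ π ⟨z, z.2⟩ ∈ ⨆ c, (H c).map π) hx'
        ?_ ⟨0, rfl, zero_mem (⨆ c, (H c).map π)⟩ ?_
      · intro c y hy
        obtain ⟨z, rfl⟩ := Submodule.Quotient.mk_surjective _ y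
        exact ⟨z, rfl, Submodule.mem_iSup_of_mem c ⟨⟨z, z.2⟩, hcP c z hy, rfl⟩⟩
      · rintro _ _ ⟨z, rfl, hz⟩ ⟨w, rfl, hw⟩
        exact ⟨z + w, rfl, add_mem hz hw⟩
    obtain ⟨z, hz, hzmem⟩ := key
    have hdiff : π ⟨z, z.2⟩ = π x :=
      (Submodule.Quotient.eq _).2 ((Submodule.Quotient.eq _).1 hz : _)
    rw [hdiff] at hzmem
    exact hzmem

end Layers

/-! ### Hereditary rings -/

section Hereditary

variable {R : Type u} [Ring R]

theorem isRightHereditary_of_isCountablyGenerated_rightLayer (hreg : IsVonNeumannRegular R)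
    {σ : Ordinal.{u}} (hσ : loewyLength Rᵐᵒᵖ R = σ + 1) (hcard : σ.card ≤ ℵ₀)
    (hcg : ∀ α : Ordinal.{u}, 0 < α → α < σ → IsCountablyGenerated Rᵐᵒᵖ (RightLayer R α)) :
    IsRightHereditary R := by
  exact projective_of_filtration hreg.isComplemented_span_singleton_right hcard _
    (socleSeq_zero _ _) (fun α hα x hx => exists_mem_socleSeq_of_isSuccLimit hα hx)
    (socleSeq_add_one_eq_top hσ)
    (fun α _ => inferInstance) hcg

theorem isLeftHereditary_of_isCountablyGenerated_rightLayer (hreg : IsVonNeumannRegular R)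
    (hpfa : HasRightPFA R) {σ : Ordinal.{u}} (hσ : loewyLength Rᵐᵒᵖ R = σ + 1)
    (hcard : σ.card ≤ ℵ₀)
    (hcg : ∀ α : Ordinal.{u}, 0 < α → α < σ → IsCountablyGenerated Rᵐᵒᵖ (RightLayer R α)) :
    IsLeftHereditary R := by
  refine projective_of_filtration hreg.isComplemented_span_singleton hcard (socleIdeal R)
    ?_ (fun α hα x hx => exists_mem_socleSeq_of_isSuccLimit hα hx) ?_ (fun α _ => ?_)
    fun α h0 hα => ?_
  · ext x
    have : x ∈ socleSeq Rᵐᵒᵖ R 0 ↔ x = 0 := by rw [socleSeq_zero, Submodule.mem_bot]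
    exact this
  · ext x
    have : x ∈ socleSeq Rᵐᵒᵖ R (σ + 1) := by
      rw [socleSeq_add_one_eq_top hσ]; trivial
    exact iff_of_true this trivial
  · obtain ⟨D, hD, hsup⟩ := exists_iSup_eq_top_leftLayer hreg hpfa α
    exact isSemisimpleModule_of_isSemisimpleModule_submodule' (fun c => (hD c).1) hsup
  · obtain ⟨D, hD, hsup⟩ := exists_iSup_eq_top_leftLayer hreg hpfa α
    have : Countable (isotypicComponents Rᵐᵒᵖ (RightLayer R α)) :=
      Cardinal.mk_le_aleph0_iff.1 ((isCountablyGenerated_rightLayer_iff hreg hpfa α).1 (hcg α h0 hα))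
    refine .of_iSup_eq_top (fun c => ?_) hsup
    have := (hD c).2
    exact .of_finite

/-- The left annihilator of the right socle is zero: the socle is essential and, `R` being regular,
its elements `y = a * r` satisfy `y = a * (r * s * y)` with `r * s * y` again in the socle. -/
theorem eq_zero_of_mul_socleSeq_one (hreg : IsVonNeumannRegular R)
    (hsemi : IsSemiartinian Rᵐᵒᵖ R) {a : R} (ha : ∀ t ∈ socleSeq Rᵐᵒᵖ R 1, a * t = 0) :
    a = 0 := by
  by_contra hne
  let f : R →ₗ[Rᵐᵒᵖ] R := DistribSMul.toLinearMap Rᵐᵒᵖ R a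
  have hker : LinearMap.ker f ≠ ⊤ := fun h => hne (by
    have : (1 : R) ∈ LinearMap.ker f := by rw [h]; trivial
    simpa [f] using this)
  obtain ⟨z, hz, hz0⟩ := Submodule.exists_mem_ne_zero_of_ne_bot (hsemi _ hker)
  obtain ⟨r, rfl⟩ := Submodule.Quotient.mk_surjective _ z
  have hmem : a * r ∈ socle Rᵐᵒᵖ R :=
    map_socle_le ((LinearMap.ker f).liftQ f le_rfl) ⟨_, hz, rfl⟩
  have hmem1 : a * r ∈ socleSeq Rᵐᵒᵖ R 1 := by
    rw [← zero_add (1 : Ordinal), socleSeq_add_one]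
    exact map_socle_le (Submodule.mkQ _) ⟨_, hmem, rfl⟩
  obtain ⟨s, hs⟩ := hreg (a * r)
  refine hz0 ((Submodule.Quotient.mk_eq_zero _).2 (LinearMap.mem_ker.2 ?_))
  change a * r = 0
  rw [← hs, mul_assoc a r s, mul_assoc a]
  exact ha _ (mul_mem_socleSeq 1 _ hmem1)

/-- In a dual basis `(x i, f i)` of a projective right ideal `I`, only countably many of the `f i`
are nonzero on the countably generated module `I ⊓ S 1`, and an `f i` vanishing there is zero. -/
theorem IsRightHereditary.isCountablyGenerated (hher : IsRightHereditary R)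
    (hreg : IsVonNeumannRegular R) (hpfa : HasRightPFA R) (hsemi : IsSemiartinian Rᵐᵒᵖ R)
    (h0 : numComponents R 0 ≤ ℵ₀) (I : Submodule Rᵐᵒᵖ R) : IsCountablyGenerated Rᵐᵒᵖ I := by
  obtain ⟨S, hS⟩ : ∃ S, S = socleSeq Rᵐᵒᵖ R (0 + 1) := ⟨_, rfl⟩
  have e : RightLayer R 0 ≃ₗ[Rᵐᵒᵖ] S := by
    rw [hS]
    refine Submodule.quotEquivOfEqBot _ ?_
    rw [socleSeq_zero, Submodule.submoduleOf, Submodule.comap_bot, Submodule.ker_subtype]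
  rw [zero_add] at hS
  have hScg : IsCountablyGenerated Rᵐᵒᵖ S :=
    ((isCountablyGenerated_rightLayer_iff hreg hpfa 0).2 h0).of_surjective e.toLinearMap
      e.surjective
  have hSss : IsSemisimpleModule Rᵐᵒᵖ S := .congr e.symm
  obtain ⟨Y, hY, hYspan⟩ : IsCountablyGenerated Rᵐᵒᵖ (S.submoduleOf I) := by
    let g : S.submoduleOf I →ₗ[Rᵐᵒᵖ] S :=
      (I.subtype ∘ₗ (S.submoduleOf I).subtype).codRestrict S fun x => x.2
    have hg : Function.Injective g := fun x y hxy =>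
      Subtype.ext (Subtype.ext (congrArg Subtype.val hxy :))
    let eg := LinearEquiv.ofInjective g hg
    exact (hScg.submodule (LinearMap.range g)).of_surjective eg.symm.toLinearMap eg.symm.surjective
  obtain ⟨f, hf⟩ := hher I
  let B : Set I := ⋃ y ∈ Y, ((f (y : I)).support : Set I)
  have hB : B.Countable := hY.biUnion fun y _ => Finset.countable_toSet _
  have hvanish : ∀ i ∉ B, ∀ y : I, (y : R) ∈ S → f y i = 0 := by
    intro i hi
    let F : S.submoduleOf I →ₗ[Rᵐᵒᵖ] Rᵐᵒᵖ :=
      Finsupp.lapply i ∘ₗ f ∘ₗ (S.submoduleOf I).subtype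
    have hF : F = 0 := by
      refine LinearMap.ext_on hYspan fun y hy => ?_
      by_contra h
      exact hi (Set.mem_biUnion hy (Finsupp.mem_support_iff.2 h))
    intro y hy
    exact congrArg (fun G : S.submoduleOf I →ₗ[Rᵐᵒᵖ] Rᵐᵒᵖ => G ⟨y, hy⟩) hF
  have hzero : ∀ i ∉ B, ∀ x : I, f x i = 0 := by
    intro i hi x
    rw [← unop_eq_zero_iff]
    refine eq_zero_of_mul_socleSeq_one hreg hsemi fun t ht => ?_
    have hmem : ((op t • x : I) : R) ∈ S := hS ▸ mul_mem_socleSeq 1 (x : R) ht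
    have := hvanish i hi _ hmem
    rw [map_smul, Finsupp.smul_apply] at this
    exact congrArg unop this
  refine ⟨B, hB, eq_top_iff.2 fun x _ => ?_⟩
  rw [← hf x, Finsupp.linearCombination_apply]
  refine Submodule.sum_mem _ fun i hi => Submodule.smul_mem _ _ (Submodule.subset_span ?_)
  by_contra hiB
  exact Finsupp.mem_support_iff.1 hi (hzero i hiB x)

end Hereditary

end SemiartinianRing

theorem lemma2p3 (R : Type u) [Ring R]
    (hreg : IsVonNeumannRegular R)
    (hsemi : IsSemiartinian Rᵐᵒᵖ R)
    (hpfa : HasRightPFA R)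
    (σ : Ordinal.{u}) (hσ : loewyLength Rᵐᵒᵖ R = σ + 1) :
    -- a proper layer is countably generated iff it has countably many homogeneous components
    (∀ α : Ordinal.{u}, 0 < α → α < σ →
      (IsCountablyGenerated Rᵐᵒᵖ (RightLayer R α) ↔ numComponents R α ≤ ℵ₀)) ∧
    ((σ.card ≤ ℵ₀ ∧
        ∀ α : Ordinal.{u}, 0 < α → α < σ → IsCountablyGenerated Rᵐᵒᵖ (RightLayer R α)) →
      IsLeftHereditary R ∧ IsRightHereditary R) ∧
    (numComponents R 0 ≤ ℵ₀ →
      ((IsLeftHereditary R ∧ IsRightHereditary R) ↔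
        (σ.card ≤ ℵ₀ ∧
          ∀ α : Ordinal.{u}, 0 < α → α < σ →
            IsCountablyGenerated Rᵐᵒᵖ (RightLayer R α)))) := by
  have hmpr : (σ.card ≤ ℵ₀ ∧
      ∀ α : Ordinal.{u}, 0 < α → α < σ → IsCountablyGenerated Rᵐᵒᵖ (RightLayer R α)) →
      IsLeftHereditary R ∧ IsRightHereditary R := fun h =>
    ⟨isLeftHereditary_of_isCountablyGenerated_rightLayer hreg hpfa hσ h.1 h.2,
      isRightHereditary_of_isCountablyGenerated_rightLayer hreg hσ h.1 h.2⟩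
  refine ⟨fun α _ _ => isCountablyGenerated_rightLayer_iff hreg hpfa α, hmpr,
    fun h0 => ⟨fun h => ?_, hmpr⟩⟩
  have hcg := h.2.isCountablyGenerated hreg hpfa hsemi h0
  exact ⟨card_le_aleph0_of_isCountablyGenerated hσ fun α => hcg _,
    fun α _ _ => (hcg _).of_surjective _ (Submodule.mkQ_surjective _)⟩
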